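/- Let $R$ be a Dedekind domain (fields are allowed) and let $M$ be an arbitrary $R$-module. Call an $R$-module $N$ \emph{virtually regular} if every cyclic submodule of $N$ is isomorphic to a direct summand of $N$, and call $M$ \emph{completely virtually regular} if every submodule of $M$ is virtually regular. For an $R$-module $N$, let $T(N)=\{x\in N : ax=0 \text{ for some } 0\neq a\in R\}$ denote its torsion submodule. Then the following statements are equivalent. (1) $M$ is completely virtually regular. (2) (i) $T(M)$ is semisimple, and (ii) every submodule $N\subseteq M$ with $N\neq T(N)$ has a direct summand isomorphic to $R$. -/

import Mathlib

/-- The `R`-module `M` has a direct summand isomorphic to the `R`-module `A`. -/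
def HasSummandIso (R : Type*) [Ring R] (M : Type*) [AddCommGroup M] [Module R M]
    (A : Type*) [AddCommGroup A] [Module R A] : Prop :=
  ∃ L : Submodule R M, (∃ C : Submodule R M, IsCompl L C) ∧ Nonempty (A ≃ₗ[R] L)

/-- `M` is virtually regular: every cyclic submodule of `M` is isomorphic to a direct summand
of `M`. -/
def IsVirtuallyRegular (R : Type*) [Ring R] (M : Type*) [AddCommGroup M] [Module R M] : Prop :=
  ∀ x : M, HasSummandIso R M (Submodule.span R {x})

/-- `M` is completely virtually regular: every submodule of `M` is virtually regular. -/
def IsCompletelyVirtuallyRegular (R : Type*) [Ring R] (M : Type*) [AddCommGroup M]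
    [Module R M] : Prop :=
  ∀ N : Submodule R M, IsVirtuallyRegular R N

open Submodule nonZeroDivisors

section General

variable {R : Type*} [Ring R] {M M' A B : Type*} [AddCommGroup M] [Module R M]
  [AddCommGroup M'] [Module R M'] [AddCommGroup A] [Module R A] [AddCommGroup B] [Module R B]

/-! (1) ⇒ (2): a torsion cyclic submodule is a quotient of `R ⧸ I` with `I ≠ ⊥`, hence Artinian, and
Artinian completely virtually regular modules are semisimple; so `T(M)` is a sum of semisimple
modules. A non-torsion element spans a copy of `R`, which gives (ii). (2) ⇒ (1): for `x ∈ N`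
non-torsion, `Rx ≅ R` and (ii) applies. For `x` torsion with annihilator `I`, `Rx` itself is a
summand: `Rx ∩ IN = 0` (`disjoint_span_singleton_smul_top`), so `Rx` embeds in `N/IN`, which is
semisimple because `R ⧸ I ≅ Rx` is. -/

theorem HasSummandIso.congr (e : M ≃ₗ[R] M') (f : A ≃ₗ[R] B) (h : HasSummandIso R M A) :
    HasSummandIso R M' B := by
  obtain ⟨L, ⟨C, hC⟩, ⟨g⟩⟩ := h
  refine ⟨L.map (e : M →ₗ[R] M'), ⟨C.map (e : M →ₗ[R] M'), ?_⟩, ⟨f.symm ≪≫ₗ g ≪≫ₗ e.submoduleMap L⟩⟩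
  exact (Submodule.orderIsoMapComap e).isCompl_iff.mp hC

theorem IsVirtuallyRegular.congr (e : M ≃ₗ[R] M') (h : IsVirtuallyRegular R M) :
    IsVirtuallyRegular R M' := by
  intro x
  refine (h (e.symm x)).congr e (e.submoduleMap _ ≪≫ₗ LinearEquiv.ofEq _ _ ?_)
  rw [Submodule.map_span, Set.image_singleton]
  simp

theorem IsCompletelyVirtuallyRegular.submodule (h : IsCompletelyVirtuallyRegular R M)
    (N : Submodule R M) : IsCompletelyVirtuallyRegular R N := fun Q ↦
  (h (Q.map N.subtype)).congr (Q.equivMapOfInjective N.subtype N.subtype_injective).symm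

/-- Artinian induction on submodules: a nonzero `Q` contains a simple submodule, so it has a simple
summand, whose complement is a smaller submodule. -/
theorem IsCompletelyVirtuallyRegular.isSemisimpleModule_of_isArtinian [IsArtinian R M]
    (h : IsCompletelyVirtuallyRegular R M) : IsSemisimpleModule R M := by
  suffices H : ∀ Q : Submodule R M, IsSemisimpleModule R Q from
    have := H ⊤
    IsSemisimpleModule.congr (Submodule.topEquiv (R := R) (M := M)).symm
  intro Q
  induction Q using WellFoundedLT.induction with
  | ind Q ih =>
  rcases IsAtomic.eq_bot_or_exists_atom_le (⊤ : Submodule R Q) with h0 | ⟨S, hS, -⟩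
  · have : Subsingleton Q := (Submodule.subsingleton_iff R).mp (subsingleton_of_bot_eq_top h0.symm)
    exact { exists_isCompl := fun p ↦ ⟨⊤, Subsingleton.elim ⊥ p ▸ isCompl_bot_top⟩ }
  obtain ⟨a, haS, ha⟩ := S.exists_mem_ne_zero_of_ne_bot hS.1
  have hspan : span R {a} = S :=
    (hS.le_iff.mp ((span_singleton_le_iff_mem a S).mpr haS)).resolve_left (by simpa using ha)
  have hsimple : IsSimpleModule R (span R {a}) := hspan ▸ isSimpleModule_iff_isAtom.mpr hS
  obtain ⟨L, ⟨C, hLC⟩, ⟨e⟩⟩ := h Q a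
  have hL : IsSimpleModule R L := IsSimpleModule.congr e.symm
  have hCtop : C ≠ ⊤ := by
    rintro rfl
    exact (isSimpleModule_iff_isAtom.mp hL).1 (eq_bot_of_isCompl_top hLC)
  have hC : IsSemisimpleModule R (C.map Q.subtype) := by
    refine ih _ (lt_of_lt_of_eq (Submodule.map_strictMono_of_injective Q.subtype_injective
      (lt_top_iff_ne_top.mpr hCtop)) ?_)
    rw [Submodule.map_subtype_top]
  have hL' : IsSemisimpleModule R (L.map Q.subtype) :=
    IsSemisimpleModule.congr (L.equivMapOfInjective Q.subtype Q.subtype_injective).symm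
  have hsup : L.map Q.subtype ⊔ C.map Q.subtype = Q := by
    rw [← Submodule.map_sup, hLC.sup_eq_top, Submodule.map_subtype_top]
  exact hsup ▸ IsSemisimpleModule.sup hL' hC

theorem isSemisimpleModule_of_forall_span_singleton
    (h : ∀ x : M, IsSemisimpleModule R (span R {x})) : IsSemisimpleModule R M :=
  isSemisimpleModule_of_isSemisimpleModule_submodule' h <|
    eq_top_iff.mpr fun x _ ↦ mem_iSup_of_mem x (mem_span_singleton_self x)

end General

theorem isSemisimpleModule_torsion_submodule {R : Type*} [CommRing R] {M : Type*}
    [AddCommGroup M] [Module R M] [IsSemisimpleModule R (torsion R M)]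
    (N : Submodule R M) : IsSemisimpleModule R (torsion R N) := by
  have hmem : ∀ x : torsion R N, ((x : N) : M) ∈ torsion R M := by
    intro x
    obtain ⟨r, hr⟩ := (mem_torsion_iff (x : N)).mp x.2
    exact (mem_torsion_iff _).mpr ⟨r, congrArg Subtype.val hr⟩
  refine IsSemisimpleModule.of_injective
    (LinearMap.codRestrict (torsion R M) (N.subtype ∘ₗ (torsion R N).subtype) hmem) ?_
  intro x y hxy
  exact Subtype.ext (Subtype.ext (congrArg (fun z : torsion R M ↦ (z : M)) hxy))

section Dedekind

variable {R : Type*} [CommRing R] [IsDedekindDomain R] {M : Type*} [AddCommGroup M] [Module R M]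

theorem IsDedekindDomain.isArtinianRing_quotient {I : Ideal R} (hI : I ≠ ⊥) :
    IsArtinianRing (R ⧸ I) := by
  have : Ring.KrullDimLE 0 (R ⧸ I) := Ring.krullDimLE_zero_iff.mpr fun J hJ ↦ by
    have hp := hJ.comap (Ideal.Quotient.mk I)
    have hle : I ≤ J.comap (Ideal.Quotient.mk I) := le_trans (by simp) (Ideal.ker_le_comap _)
    have hmax := hp.isMaximal (ne_bot_of_le_ne_bot hI hle)
    exact Ideal.map_comap_of_surjective _ Ideal.Quotient.mk_surjective J ▸
      (Ideal.map_eq_top_or_isMaximal_of_surjective _ Ideal.Quotient.mk_surjective hmax).resolve_left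
        (by rw [Ideal.map_comap_of_surjective _ Ideal.Quotient.mk_surjective]; exact hJ.ne_top)
  exact IsNoetherianRing.isArtinianRing_of_krullDimLE_zero

theorem ker_toSpanSingleton_ne_bot {x : M} (hx : x ∈ torsion R M) :
    LinearMap.ker (LinearMap.toSpanSingleton R M x) ≠ ⊥ := by
  obtain ⟨⟨r, hr⟩, hrx⟩ := (mem_torsion_iff x).mp hx
  exact (Submodule.ne_bot_iff _).mpr ⟨r, by simpa using hrx, nonZeroDivisors.ne_zero hr⟩

theorem isArtinian_span_singleton_of_mem_torsion {x : M} (hx : x ∈ torsion R M) :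
    IsArtinian R (span R {x}) := by
  have := IsDedekindDomain.isArtinianRing_quotient (ker_toSpanSingleton_ne_bot hx)
  have : IsArtinian R (R ⧸ LinearMap.ker (LinearMap.toSpanSingleton R M x)) :=
    isArtinian_of_surjective_algebraMap
      (R := R ⧸ LinearMap.ker (LinearMap.toSpanSingleton R M x)) Ideal.Quotient.mk_surjective
  exact isArtinian_of_linearEquiv (LinearMap.quotKerEquivRange _ ≪≫ₗ
    LinearEquiv.ofEq _ _ (LinearMap.range_toSpanSingleton x))

theorem IsCompletelyVirtuallyRegular.isSemisimpleModule_torsion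
    (h : IsCompletelyVirtuallyRegular R M) : IsSemisimpleModule R (torsion R M) := by
  refine isSemisimpleModule_of_forall_span_singleton fun x ↦ ?_
  have := isArtinian_span_singleton_of_mem_torsion x.2
  have := (h.submodule (span R {(x : M)})).isSemisimpleModule_of_isArtinian
  have hle : (span R {x}).map (torsion R M).subtype = span R {(x : M)} := by
    rw [Submodule.map_span, Set.image_singleton, Submodule.subtype_apply]
  exact IsSemisimpleModule.congr (equivMapOfInjective (torsion R M).subtype
    (torsion R M).subtype_injective _ ≪≫ₗ LinearEquiv.ofEq _ _ hle)

theorem IsDedekindDomain.exists_mul_eq_span_singleton_and_sup_eq_top {I : Ideal R} (hI : I ≠ ⊥) :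
    ∃ (J : Ideal R) (a : R), I * J = Ideal.span {a} ∧ I ⊔ J = ⊤ := by
  -- With `I² + (a) = I` and `(a) = IJ`, one gets `I(I + J) = I`; cancel `I`.
  obtain ⟨a, ha⟩ := IsDedekindDomain.exists_sup_span_eq (Ideal.mul_le_left : I * I ≤ I)
    (mul_ne_zero hI hI)
  obtain ⟨J, hJ⟩ := Ideal.dvd_iff_le.mpr (ha ▸ le_sup_right : Ideal.span {a} ≤ I)
  refine ⟨J, a, hJ.symm, mul_left_cancel₀ hI ?_⟩
  rw [Ideal.mul_sup, ← hJ, ha, Ideal.mul_top]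

/-- A cyclic torsion submodule is pure, provided the torsion submodule is semisimple. -/
theorem disjoint_span_singleton_smul_top [IsSemisimpleModule R (torsion R M)] {x : M}
    (hx : x ∈ torsion R M) :
    Disjoint (span R {x}) (LinearMap.ker (LinearMap.toSpanSingleton R M x) • ⊤ : Submodule R M) := by
  have hI0 := ker_toSpanSingleton_ne_bot hx
  have hIker : ∀ i ∈ LinearMap.ker (LinearMap.toSpanSingleton R M x), i • x = 0 := fun i hi ↦ hi
  generalize LinearMap.ker (LinearMap.toSpanSingleton R M x) = I at hI0 hIker ⊢
  have hIx : ∀ i ∈ I, ∀ z ∈ span R {x}, i • z = 0 := by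
    intro i hi z hz
    obtain ⟨r, rfl⟩ := mem_span_singleton.mp hz
    rw [smul_comm, hIker i hi, smul_zero]
  obtain ⟨J, a, hJ, htop⟩ :=
    IsDedekindDomain.exists_mul_eq_span_singleton_and_sup_eq_top hI0
  have haI : a ∈ I := by
    have h : a ∈ I * J := by rw [hJ]; exact Ideal.mem_span_singleton_self a
    exact Ideal.mul_le_left h
  have hle : span R {x} ≤ torsion R M := (span_singleton_le_iff_mem _ _).mpr hx
  -- A retraction `T(M) → Rx`. It turns `b • y = a • m`, with `b ∈ J` and `m` torsion, into `b • y =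
  -- a • π m`, which is zero as `a ∈ I`. Thus `I` and `J` both kill `y`.
  obtain ⟨π, hπ⟩ := IsSemisimpleModule.extension_property (inclusion hle)
    (inclusion_injective hle) LinearMap.id
  rw [Submodule.disjoint_def]
  intro y hyx hyI
  have hdiv : ∀ b ∈ J, ∃ m : M, b • y = a • m := by
    intro b hb
    refine Submodule.smul_induction_on (p := fun z ↦ ∃ m : M, b • z = a • m) hyI ?_ ?_
    · intro i hi n _
      obtain ⟨c, hc⟩ := Ideal.mem_span_singleton'.mp (hJ.le (Ideal.mul_mem_mul hi hb))
      exact ⟨c • n, by rw [smul_smul, smul_smul, mul_comm b, ← hc, mul_comm]⟩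
    · rintro u v ⟨m, hm⟩ ⟨n, hn⟩
      exact ⟨m + n, by rw [smul_add, smul_add, hm, hn]⟩
  have hJy : ∀ b ∈ J, b • y = 0 := by
    intro b hb
    obtain ⟨m, hm⟩ := hdiv b hb
    rcases eq_or_ne a 0 with rfl | ha
    · rw [hm, zero_smul]
    have hmt : m ∈ torsion R M := by
      obtain ⟨r, hr⟩ := (mem_torsion_iff y).mp (hle hyx)
      refine (mem_torsion_iff m).mpr ⟨r * ⟨a, mem_nonZeroDivisors_of_ne_zero ha⟩, ?_⟩
      rw [Submonoid.smul_def] at hr ⊢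
      rw [Submonoid.coe_mul, mul_smul, ← hm, smul_comm, hr, smul_zero]
    have hπy : π (inclusion hle ⟨y, hyx⟩) = ⟨y, hyx⟩ := LinearMap.congr_fun hπ ⟨y, hyx⟩
    have hby : b • (inclusion hle ⟨y, hyx⟩) = a • (⟨m, hmt⟩ : torsion R M) := Subtype.ext hm
    have hπb : b • (⟨y, hyx⟩ : span R {x}) = a • π ⟨m, hmt⟩ := by
      rw [← hπy, ← π.map_smul, hby, π.map_smul]
    have hyb : b • y = a • (π ⟨m, hmt⟩ : M) := congrArg Subtype.val hπb
    rw [hyb, hIx a haI _ (π _).2]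
  obtain ⟨i, hi, b, hb, hib⟩ := Submodule.mem_sup.mp (htop.ge mem_top : (1 : R) ∈ I ⊔ J)
  rw [← one_smul R y, ← hib, add_smul, hIx i hi y hyx, hJy b hb, add_zero]

theorem exists_isCompl_span_singleton_of_mem_torsion [IsSemisimpleModule R (torsion R M)] {x : M}
    (hx : x ∈ torsion R M) : ∃ C : Submodule R M, IsCompl (span R {x}) C := by
  have hdisj := disjoint_span_singleton_smul_top hx
  set I : Ideal R := LinearMap.ker (LinearMap.toSpanSingleton R M x) with hIdef
  set IM : Submodule R M := I • ⊤
  have hle : span R {x} ≤ torsion R M := (span_singleton_le_iff_mem _ _).mpr hx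
  have : IsSemisimpleModule R (span R {x}) :=
    IsSemisimpleModule.of_injective (inclusion hle) (inclusion_injective hle)
  have : IsSemisimpleModule R (R ⧸ I) :=
    IsSemisimpleModule.congr (LinearMap.quotKerEquivRange _ ≪≫ₗ
      LinearEquiv.ofEq _ _ (LinearMap.range_toSpanSingleton x))
  have : IsSemisimpleModule R (M ⧸ IM) := by
    refine isSemisimpleModule_of_forall_span_singleton fun q ↦ ?_
    -- Every cyclic submodule of `M ⧸ IM` is a quotient of the semisimple `R ⧸ I`.
    have hq : I ≤ LinearMap.ker (LinearMap.toSpanSingleton R (M ⧸ IM) q) := by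
      intro i hi
      obtain ⟨n, rfl⟩ := IM.mkQ_surjective q
      rw [LinearMap.mem_ker, LinearMap.toSpanSingleton_apply, ← map_smul, ← LinearMap.mem_ker,
        ker_mkQ]
      exact smul_mem_smul hi mem_top
    have hrange := IsSemisimpleModule.range (I.liftQ _ hq)
    rwa [range_liftQ, LinearMap.range_toSpanSingleton] at hrange
  obtain ⟨ρ, hρ⟩ := IsSemisimpleModule.extension_property (IM.mkQ ∘ₗ (span R {x}).subtype)
    (by
      rw [← LinearMap.ker_eq_bot, LinearMap.ker_comp, ker_mkQ, ← disjoint_iff_comap_eq_bot]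
      exact hdisj) LinearMap.id
  exact ⟨_, LinearMap.isCompl_of_proj (f := ρ ∘ₗ IM.mkQ) (LinearMap.congr_fun hρ)⟩

theorem nonempty_linearEquiv_span_singleton {x : M} (hx : x ∉ torsion R M) :
    Nonempty (R ≃ₗ[R] span R {x}) := by
  have hinj : Function.Injective (LinearMap.toSpanSingleton R M x) := by
    rw [← LinearMap.ker_eq_bot, eq_bot_iff]
    intro r hr
    by_contra h0
    exact hx ((mem_torsion_iff x).mpr
      ⟨⟨r, mem_nonZeroDivisors_of_ne_zero (by simpa using h0)⟩, by simpa using hr⟩)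
  exact ⟨LinearEquiv.ofInjective _ hinj ≪≫ₗ
    LinearEquiv.ofEq _ _ (LinearMap.range_toSpanSingleton x)⟩

end Dedekind

theorem mainTheorem6 {R : Type*} [CommRing R] [IsDedekindDomain R]
    {M : Type*} [AddCommGroup M] [Module R M] :
    IsCompletelyVirtuallyRegular R M ↔
      (IsSemisimpleModule R (Submodule.torsion R M) ∧
        ∀ N : Submodule R M, Submodule.torsion R N ≠ ⊤ → HasSummandIso R N R) := by
  refine ⟨fun h ↦ ⟨h.isSemisimpleModule_torsion, fun N hN ↦ ?_⟩, fun ⟨hT, hF⟩ N x ↦ ?_⟩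
  · obtain ⟨x, -, hx⟩ := SetLike.exists_of_lt (lt_top_iff_ne_top.mpr hN)
    obtain ⟨e⟩ := nonempty_linearEquiv_span_singleton hx
    exact (h N x).congr (LinearEquiv.refl R N) e.symm
  · by_cases hx : x ∈ torsion R N
    · have := isSemisimpleModule_torsion_submodule N
      exact ⟨_, exists_isCompl_span_singleton_of_mem_torsion hx, ⟨LinearEquiv.refl R _⟩⟩
    · obtain ⟨e⟩ := nonempty_linearEquiv_span_singleton hx
      exact (hF N fun h ↦ hx (h ▸ mem_top)).congr (LinearEquiv.refl R N) e
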